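/- For an ordinal $\alpha$ with $1\le\alpha<\omega_1$, fix for every limit ordinal $\delta\le\alpha$ a strictly increasing sequence $(\delta_k)_{k\in\mathbb N}$ cofinal in $\delta$. Let $T_\alpha\subset\mathbb N^{<\omega}$ be the well-founded tree, with a rank attached to each node, defined as follows: the root $\langle\rangle$ has rank $\alpha$; if $\sigma\in T_\alpha$ has limit rank $\delta$ then, for every $k$, $\sigma^\frown k\in T_\alpha$ and it has rank $\delta_k$; if $\sigma\in T_\alpha$ has rank $\beta+1$ then, for every $k$, $\sigma^\frown k\in T_\alpha$ and it has rank $\beta$; nodes of rank $0$ have no children. Let $\mathscr L_\alpha$ be the set of leaves of $T_\alpha$, that is, of the nodes of rank $0$. For $x\in 2^{\mathscr L_\alpha}$ let $T^x\colon T_\alpha\to\{0,1\}$ be the unique labelling that extends $x$ and satisfies, for every $\sigma\in T_\alpha\setminus\mathscr L_\alpha$, $T^x(\sigma)=0$ if and only if $T^x(\sigma^\frown k)=1$ for some $k$. Let $\mathbb X_\alpha=2^{\mathscr L_\alpha}\times\mathscr P(\mathbb N)$, with the usual (product) topology, where $\mathscr P(\mathbb N)$ is identified with $2^{\mathbb N}$.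 Let $K_\alpha$ be the directed graph on $\mathbb X_\alpha$ in which there is an edge from $(x,y)$ to $(x',y')$ if and only if $x'=x$, $T^x(\langle\rangle)=0$ and, for the least $n$ such that $T^x(\langle n\rangle)=1$, we have $y\mathbin{\triangle}y'=\{n\}$ and $n\notin y$. **Theorem.** For every ordinal $\alpha$ with $1\le\alpha<\omega_1$ and every choice of cofinal sequences as above, the directed graph $K_\alpha$ is Borel (its set of edges is a Borel subset of $\mathbb X_\alpha\times\mathbb X_\alpha$), and it has no countable $\boldsymbol\Sigma^0_\alpha$ colouring: there is no map $c\colon\mathbb X_\alpha\to\mathbb N$ such that $c^{-1}(\{n\})$ is a $\boldsymbol\Sigma^0_\alpha$ subset of $\mathbb X_\alpha$ for every $n$, and $c(p)\ne c(q)$ whenever there is an edge of $K_\alpha$ from $p$ to $q$. -/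

import Mathlib

open Ordinal Order
open scoped MeasureTheory

/-- The boldface additive Borel class `Σ⁰_α` of a (metrizable) topological space, for `α ≥ 1`:
`Σ⁰_1` consists of the open sets and, for `α > 1`, a set is `Σ⁰_α` when it is the union of
countably many sets, each of them the complement of a `Σ⁰_β` set for some `1 ≤ β < α`. -/
inductive IsSigma0 {X : Type*} [TopologicalSpace X] : Ordinal.{0} → Set X → Prop
  | isOpen {U : Set X} (hU : IsOpen U) : IsSigma0 1 U
  | iUnion {α : Ordinal.{0}} (hα : 1 < α) (β : ℕ → Ordinal.{0}) (A : ℕ → Set X)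
      (hβ : ∀ n, 1 ≤ β n) (hβα : ∀ n, β n < α) (hA : ∀ n, IsSigma0 (β n) (A n)ᶜ) :
      IsSigma0 α (⋃ n, A n)

/-- A countable `Σ⁰_α` colouring of a directed graph on a topological space: adjacent vertices
get distinct colours, and every colour class is `Σ⁰_α`. -/
structure IsSigmaColouring {X : Type*} [TopologicalSpace X] (α : Ordinal.{0}) (G : Digraph X)
    (c : X → ℕ) : Prop where
  proper : ∀ u v, G.Adj u v → c u ≠ c v
  isSigma0 : ∀ n, IsSigma0 α (c ⁻¹' {n})

/-- A choice, for every limit ordinal `δ ≤ α`, of an increasing sequence `(δ_k)` cofinal in `δ`.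
(The values of `seq` at other ordinals play no role.) -/
structure CofinalSequences (α : Ordinal.{0}) where
  seq : Ordinal.{0} → ℕ → Ordinal.{0}
  strictMono : ∀ δ ≤ α, IsSuccLimit δ → StrictMono (seq δ)
  lt : ∀ δ ≤ α, IsSuccLimit δ → ∀ k, seq δ k < δ
  cofinal : ∀ δ ≤ α, IsSuccLimit δ → ∀ β < δ, ∃ k, β < seq δ k

namespace CofinalSequences

variable {α : Ordinal.{0}} (F : CofinalSequences α)

/-- `F.HasRank σ β`: the finite sequence `σ` is a node of the tree `T_α`, and its rank is `β`. -/
inductive HasRank : List ℕ → Ordinal.{0} → Prop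
  | root : HasRank [] α
  | limit {σ : List ℕ} {δ : Ordinal.{0}} (hσ : HasRank σ δ) (hδ : IsSuccLimit δ) (k : ℕ) :
      HasRank (σ ++ [k]) (F.seq δ k)
  | succ {σ : List ℕ} {β : Ordinal.{0}} (hσ : HasRank σ (β + 1)) (k : ℕ) :
      HasRank (σ ++ [k]) β

/-- The tree `T_α`. -/
def tree : Set (List ℕ) := {σ | ∃ β, F.HasRank σ β}

/-- The set `𝓛_α` of leaves of `T_α`: the nodes of rank `0`. -/
def leaves : Set (List ℕ) := {σ | F.HasRank σ 0}

variable {F}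

theorem HasRank.le {σ : List ℕ} {β : Ordinal.{0}} (h : F.HasRank σ β) : β ≤ α := by
  induction h with
  | root => exact le_rfl
  | limit _ hδ k ih => exact (F.lt _ ih hδ k).le.trans ih
  | succ _ k ih => exact (le_add_of_nonneg_right zero_le).trans ih

theorem HasRank.unique {σ : List ℕ} {β γ : Ordinal.{0}} (h : F.HasRank σ β)
    (h' : F.HasRank σ γ) : β = γ := by
  induction h generalizing γ with
  | root =>
    generalize hτ : ([] : List ℕ) = τ at h'
    cases h' with
    | root => rfl
    | limit _ _ k => simp at hτ
    | succ _ k => simp at hτ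
  | @limit σ δ _ hδ k ih =>
    generalize hτ : σ ++ [k] = τ at h'
    cases h' with
    | root => simp at hτ
    | limit h₂ _ l =>
      obtain ⟨rfl, h₃⟩ := List.append_inj' hτ rfl
      rw [ih h₂, List.singleton_inj.1 h₃]
    | @succ σ₂ β₂ h₂ l =>
      obtain ⟨rfl, -⟩ := List.append_inj' hτ rfl
      rw [ih h₂] at hδ
      exact absurd hδ (by simp)
  | @succ σ β _ k ih =>
    generalize hτ : σ ++ [k] = τ at h'
    cases h' with
    | root => simp at hτ
    | limit h₂ hδ l =>
      obtain ⟨rfl, -⟩ := List.append_inj' hτ rfl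
      rw [← ih h₂] at hδ
      exact absurd hδ (by simp)
    | succ h₂ l =>
      obtain ⟨rfl, -⟩ := List.append_inj' hτ rfl
      simpa using ih h₂

theorem HasRank.exists_child {σ : List ℕ} {β : Ordinal.{0}} (h : F.HasRank σ β) (hβ : β ≠ 0)
    (k : ℕ) : ∃ γ < β, F.HasRank (σ ++ [k]) γ := by
  rcases zero_or_succ_or_isSuccLimit β with h0 | ⟨γ, rfl⟩ | hl
  · exact absurd h0 hβ
  · exact ⟨γ, lt_succ γ, .succ (by simpa using h) k⟩
  · exact ⟨_, F.lt β h.le hl k, .limit h hl k⟩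

variable (F)

theorem nil_mem_tree : [] ∈ F.tree := ⟨α, .root⟩

/-- The rank of a node of `T_α`. -/
noncomputable def rank (σ : F.tree) : Ordinal.{0} := σ.2.choose

variable {F}

theorem hasRank_rank (σ : F.tree) : F.HasRank σ (F.rank σ) := σ.2.choose_spec

theorem append_mem_tree {σ : List ℕ} (hσ : σ ∈ F.tree) (h : σ ∉ F.leaves) (k : ℕ) :
    σ ++ [k] ∈ F.tree := by
  obtain ⟨β, hβ⟩ := hσ
  obtain ⟨γ, -, hγ⟩ := hβ.exists_child (fun h0 => h (by subst h0; exact hβ)) k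
  exact ⟨γ, hγ⟩

theorem rank_append_lt {σ : List ℕ} (hσ : σ ∈ F.tree) (h : σ ∉ F.leaves) (k : ℕ) :
    F.rank ⟨σ ++ [k], append_mem_tree hσ h k⟩ < F.rank ⟨σ, hσ⟩ := by
  have h₁ := hasRank_rank ⟨σ, hσ⟩
  obtain ⟨γ, hγ, hγ'⟩ := h₁.exists_child (fun h0 => h (by rw [h0] at h₁; exact h₁)) k
  rwa [(hasRank_rank ⟨σ ++ [k], append_mem_tree hσ h k⟩).unique hγ']

open Classical in
/-- The labelling `T^x` of `T_α` determined by a labelling `x` of its leaves (`true` is the label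
`1`, `false` is the label `0`): `T^x` extends `x` and, at a node `σ` that is not a leaf,
`T^x(σ) = 0` if and only if `T^x(σ⌢k) = 1` for some `k`. -/
noncomputable def label (x : F.leaves → Bool) (σ : List ℕ) (hσ : σ ∈ F.tree) : Bool :=
  if h : σ ∈ F.leaves then x ⟨σ, h⟩
  else if ∃ k : ℕ, label x (σ ++ [k]) (append_mem_tree hσ h k) = true then false
  else true
termination_by F.rank ⟨σ, hσ⟩
decreasing_by exact rank_append_lt hσ h k

variable (F)

/-- The space `𝕏_α = 2^{𝓛_α} × 𝒫(ℕ)` with the product topology; a subset of `ℕ` is given by its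
characteristic function. -/
abbrev Space : Type := (F.leaves → Bool) × (ℕ → Bool)

/-- The subset of `ℕ` with characteristic function `y`. -/
def toSet (y : ℕ → Bool) : Set ℕ := {m | y m = true}

/-- The directed graph `K_α` on `𝕏_α`: there is an edge from `(x, y)` to `(x', y')` when `x' = x`,
`T^x(⟨⟩) = 0` and, for the least `n` such that `T^x(⟨n⟩) = 1`, `y △ y' = {n}` and `n ∉ y`. -/
def graphK : Digraph F.Space where
  Adj p q := q.1 = p.1 ∧ label p.1 [] F.nil_mem_tree = false ∧
    ∃ n : ℕ, IsLeast {k : ℕ | ∃ h : [k] ∈ F.tree, label p.1 [k] h = true} n ∧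
      symmDiff (toSet p.2) (toSet q.2) = {n} ∧ n ∉ toSet p.2

end CofinalSequences

/-! Suppose the sets `A n` are `Σ⁰_α` and cover `𝕏_α`. Points are lifted to labellings of the whole
tree that also record the least witness for each label 0. This finer topology is Polish and makes
every node label continuous, so Baire category applies to open sets such as "the root has label 1".
A condition forces a set when the set contains almost every point of the condition.

Choose a condition that gives the root label 1 and forces some `A n`. A `Σ⁰_α` set is already forced
by the information of rank at most some `δ < α` (`IsLeafMap.exists_sim_of_forces`), by induction on
the class and the back-and-forth property `Condition.Sim.exists_le`. The root has rank `α`, so its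
label 1 can be dropped without losing that `A n` is forced. The root can then be given label 0,
after all its children below any prescribed `N` have been given label 0. Its least witness `k` is
now so large that flipping the digit `k` of `y` stays inside the condition. As flipping is a
homeomorphism, a generic point and its flip both lie in `A n`, and they form an edge
(`IsLeafMap.exists_flip`).

Borelness is separate: each label is a Borel function of `x`, by induction on rank. -/

section

/-! ### Witnessed labellings and forcing conditions -/

/-- The properties of the rank function of `T_α` that matter for the forcing argument. Nodes of
rank `0` (including the sequences outside the tree) count as leaves. -/
structure IsTreeRank (ρ : List ℕ → Ordinal.{0}) : Prop where
  child_lt : ∀ σ k, ρ σ ≠ 0 → ρ (σ ++ [k]) < ρ σ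
  finite_child : ∀ σ β, β < ρ σ → {k | ρ (σ ++ [k]) < β}.Finite

/-- Labellings of the tree with witnesses: `w σ = 0` means that `σ` has label `1`, and `w σ = k + 1`
means that `σ` has label `0` and, unless `σ` is a leaf, that `k` is least such that
`σ⌢k` has label `1`. -/
def labellings (ρ : List ℕ → Ordinal.{0}) : Set (List ℕ → ℕ) :=
  {w | ∀ σ, (ρ σ = 0 → w σ ≤ 1) ∧ (ρ σ ≠ 0 → ∀ k, (w σ = 0 → w (σ ++ [k]) ≠ 0) ∧
    (w σ = k + 1 → w (σ ++ [k]) = 0 ∧ ∀ j < k, w (σ ++ [j]) ≠ 0))}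

/-- Forcing conditions: a finite set of nodes with label `1`, a finite set of leaves with label `0`,
and a nonempty open set of subsets of `ℕ`. -/
structure Condition (ρ : List ℕ → Ordinal.{0}) where
  pos : Finset (List ℕ)
  neg : Finset (List ℕ)
  ys : Set (ℕ → Bool)
  isOpen_ys : IsOpen ys
  nonempty_ys : ys.Nonempty
  rank_neg : ∀ σ ∈ neg, ρ σ = 0
  disj : ∀ σ ∈ neg, σ ∉ pos
  indep : ∀ σ ∈ pos, ρ σ ≠ 0 → ∀ k, σ ++ [k] ∉ pos

variable {ρ : List ℕ → Ordinal.{0}}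

theorem exists_mem_labellings (L : List ℕ → Prop)
    (h₁ : ∀ σ k, ρ σ ≠ 0 → L σ → ¬ L (σ ++ [k])) (h₂ : ∀ σ, ρ σ ≠ 0 → ¬ L σ → ∃ k, L (σ ++ [k])) :
    ∃ w ∈ labellings ρ, ∀ σ, w σ = 0 ↔ L σ := by
  classical
  let w : List ℕ → ℕ := fun σ =>
    if L σ then 0 else if ρ σ = 0 then 1 else sInf {k | L (σ ++ [k])} + 1
  have hw : ∀ σ, w σ = 0 ↔ L σ := by
    intro σ
    simp only [w]
    split_ifs <;> simp_all
  refine ⟨w, fun σ => ⟨fun h => ?_, fun h k => ⟨fun h0 => ?_, fun hk => ?_⟩⟩, hw⟩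
  · simp only [w]
    split_ifs <;> simp
  · rw [Ne, hw]
    exact h₁ σ k h ((hw σ).1 h0)
  · have hL : ¬ L σ := fun hL => by simp [(hw σ).2 hL] at hk
    have hk' : sInf {k | L (σ ++ [k])} = k := by simpa [w, hL, h] using hk
    refine ⟨(hw _).2 ?_, fun j hj => ?_⟩
    · rw [← hk']
      exact Nat.sInf_mem (s := {k | L (σ ++ [k])}) (h₂ σ h hL)
    · rw [Ne, hw]
      rw [← hk'] at hj
      exact Nat.notMem_of_lt_sInf hj

theorem exists_fresh (S : Finset (List ℕ)) : ∃ m : ℕ, ∀ σ ∈ S, m ∉ σ := by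
  -- A member of a sequence is at most its sum, so exceeding all the sums suffices.
  refine ⟨S.sup List.sum + 1, fun σ hσ hm => ?_⟩
  have h₁ := List.le_sum_of_mem hm
  have h₂ := Finset.le_sup (f := List.sum) hσ
  omega

namespace Condition

instance : Preorder (Condition ρ) where
  le p q := q.pos ⊆ p.pos ∧ q.neg ⊆ p.neg ∧ p.ys ⊆ q.ys
  le_refl p := ⟨subset_rfl, subset_rfl, subset_rfl⟩
  le_trans p q r h h' := ⟨h'.1.trans h.1, h'.2.1.trans h.2.1, h.2.2.trans h'.2.2⟩

/-- The set of points that satisfy a condition. -/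
def toSet (p : Condition ρ) : Set (labellings ρ × (ℕ → Bool)) :=
  {z | (∀ σ ∈ p.pos, z.1.1 σ = 0) ∧ (∀ σ ∈ p.neg, z.1.1 σ ≠ 0) ∧ z.2 ∈ p.ys}

theorem toSet_mono {p q : Condition ρ} (h : p ≤ q) : p.toSet ⊆ q.toSet := fun _ hz =>
  ⟨fun σ hσ => hz.1 σ (h.1 hσ), fun σ hσ => hz.2.1 σ (h.2.1 hσ), h.2.2 hz.2.2⟩

/-- A labelling compatible with `p`, on reversed sequences. -/
def revLabel (p : Condition ρ) : List ℕ → Prop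
  | [] => [] ∈ p.pos
  | m :: t => (m :: t).reverse ∈ p.pos ∨ (¬ p.revLabel t ∧ (m :: t).reverse ∉ p.neg ∧
      ∀ k, (m :: t).reverse ++ [k] ∉ p.pos)

theorem revLabel_append (p : Condition ρ) (σ : List ℕ) (m : ℕ) :
    p.revLabel (σ ++ [m]).reverse ↔ σ ++ [m] ∈ p.pos ∨ (¬ p.revLabel σ.reverse ∧
      σ ++ [m] ∉ p.neg ∧ ∀ k, σ ++ [m] ++ [k] ∉ p.pos) := by
  simp [revLabel]

theorem revLabel_of_mem (p : Condition ρ) {σ : List ℕ} (h : σ ∈ p.pos) :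
    p.revLabel σ.reverse := by
  induction σ using List.reverseRecOn with
  | nil => simpa [revLabel] using h
  | append_singleton σ m _ => exact (p.revLabel_append σ m).2 (.inl h)

theorem not_revLabel_of_mem (p : Condition ρ) {σ : List ℕ} (h : σ ∈ p.neg) :
    ¬ p.revLabel σ.reverse := by
  induction σ using List.reverseRecOn with
  | nil => simpa [revLabel] using p.disj _ h
  | append_singleton σ m _ =>
    rw [revLabel_append]
    rintro (h' | h')
    exacts [p.disj _ h h', h'.2.1 h]

theorem not_mem_of_revLabel (p : Condition ρ) {σ : List ℕ} (hσ : ρ σ ≠ 0)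
    (h : p.revLabel σ.reverse) (k : ℕ) : σ ++ [k] ∉ p.pos := by
  induction σ using List.reverseRecOn with
  | nil => exact p.indep _ (by simpa [revLabel] using h) hσ k
  | append_singleton σ m _ =>
    rw [revLabel_append] at h
    rcases h with h | h
    exacts [p.indep _ h hσ k, h.2.2 k]

/-- Labels can be chosen from the root downwards, since only the parent-child constraints matter. A
node outside `pos` gets label 1 when its parent has label 0 and neither `neg` nor a child in `pos`
forbids it. A fresh child then always witnesses a label 0. -/
theorem nonempty_toSet (p : Condition ρ) : p.toSet.Nonempty := by
  obtain ⟨w, hw, hL⟩ := exists_mem_labellings (ρ := ρ) (fun σ => p.revLabel σ.reverse)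
    (fun σ k hσ h h' => by
      rcases (p.revLabel_append σ k).1 h' with h' | h'
      exacts [p.not_mem_of_revLabel hσ h k h', h'.1 h])
    (fun σ _ h => by
      obtain ⟨m, hm⟩ := exists_fresh (p.pos ∪ p.neg)
      refine ⟨m, (p.revLabel_append σ m).2 (.inr ⟨h, fun h' => ?_, fun k h' => ?_⟩)⟩
      · exact hm _ (Finset.mem_union_right _ h') (by simp)
      · exact hm _ (Finset.mem_union_left _ h') (by simp))
  obtain ⟨y, hy⟩ := p.nonempty_ys
  exact ⟨⟨⟨w, hw⟩, y⟩, fun σ hσ => (hL σ).2 (p.revLabel_of_mem hσ),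
    fun σ hσ h => p.not_revLabel_of_mem hσ ((hL σ).1 h), hy⟩

/-- Refining a condition by finite information about one of its points. -/
theorem exists_le_of_mem {p : Condition ρ} {z : labellings ρ × (ℕ → Bool)} (hz : z ∈ p.toSet)
    (P N : Finset (List ℕ)) (V : Set (ℕ → Bool)) (hV : IsOpen V) (hzV : z.2 ∈ V)
    (hP : ∀ σ ∈ P, z.1.1 σ = 0) (hN : ∀ σ ∈ N, ρ σ = 0 ∧ z.1.1 σ ≠ 0) :
    ∃ q ≤ p, z ∈ q.toSet ∧ q.pos = p.pos ∪ P ∧ q.neg = p.neg ∪ N ∧ q.ys = p.ys ∩ V := by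
  have hP' : ∀ σ ∈ p.pos ∪ P, z.1.1 σ = 0 := fun σ hσ =>
    (Finset.mem_union.1 hσ).elim (hz.1 σ) (hP σ)
  have hN' : ∀ σ ∈ p.neg ∪ N, z.1.1 σ ≠ 0 := fun σ hσ =>
    (Finset.mem_union.1 hσ).elim (hz.2.1 σ) fun h => (hN σ h).2
  exact ⟨{ pos := p.pos ∪ P
           neg := p.neg ∪ N
           ys := p.ys ∩ V
           isOpen_ys := p.isOpen_ys.inter hV
           nonempty_ys := ⟨z.2, hz.2.2, hzV⟩
           rank_neg := fun σ hσ => (Finset.mem_union.1 hσ).elim (p.rank_neg σ) fun h => (hN σ h).1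
           disj := fun σ hσ h => hN' σ hσ (hP' σ h)
           indep := fun σ hσ h k hk => ((z.1.2 σ).2 h k).1 (hP' σ hσ) (hP' _ hk) },
    ⟨Finset.subset_union_left, Finset.subset_union_left, Set.inter_subset_left⟩,
    ⟨hP', hN', hz.2.2, hzV⟩, rfl, rfl, rfl⟩

/-- The condition `p` explicitly gives the label `0` to `σ`. -/
def Decided (p : Condition ρ) (σ : List ℕ) : Prop :=
  (ρ σ = 0 ∧ σ ∈ p.neg) ∨ (ρ σ ≠ 0 ∧ ∃ m, σ ++ [m] ∈ p.pos)

theorem Decided.mono {p q : Condition ρ} (h : q ≤ p) {σ : List ℕ} (hp : p.Decided σ) :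
    q.Decided σ :=
  hp.imp (fun h' => ⟨h'.1, h.2.1 h'.2⟩) fun h' => ⟨h'.1, h'.2.imp fun _ hm => h.1 hm⟩

theorem Decided.not_mem {p : Condition ρ} {σ : List ℕ} (hp : p.Decided σ) : σ ∉ p.pos := by
  rcases hp with h | ⟨h, m, hm⟩
  exacts [p.disj _ h.2, fun h' => p.indep _ h' h m hm]

theorem Decided.ne_zero {p : Condition ρ} {σ : List ℕ} (hp : p.Decided σ)
    {z : labellings ρ × (ℕ → Bool)} (hz : z ∈ p.toSet) : z.1.1 σ ≠ 0 := by
  rcases hp with h | ⟨h, m, hm⟩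
  exacts [hz.2.1 _ h.2, fun h' => ((z.1.2 σ).2 h m).1 h' (hz.1 _ hm)]

/-- Label 0 at an inner node is secured by putting into `pos` the witness read off from `z`. The
last clause bounds the ranks of the nodes added. -/
theorem exists_le_decided {p : Condition ρ} {z : labellings ρ × (ℕ → Bool)} (hz : z ∈ p.toSet)
    (S : Finset (List ℕ)) (hS : ∀ σ ∈ S, z.1.1 σ ≠ 0) :
    ∃ q ≤ p, z ∈ q.toSet ∧ q.ys = p.ys ∧ (∀ σ ∈ S, q.Decided σ) ∧
      ∀ τ ∈ q.pos, τ ∈ p.pos ∨ ∃ σ ∈ S, ρ σ ≠ 0 ∧ ∃ m, τ = σ ++ [m] := by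
  classical
  obtain ⟨q, hq, hzq, hpos, hneg, hys⟩ := exists_le_of_mem hz
    ((S.filter fun σ => ρ σ ≠ 0).image fun σ => σ ++ [z.1.1 σ - 1]) (S.filter fun σ => ρ σ = 0)
    Set.univ isOpen_univ trivial
    (by
      simp only [Finset.mem_image, Finset.mem_filter]
      rintro _ ⟨σ, ⟨hσ, h⟩, rfl⟩
      have := hS σ hσ
      exact (((z.1.2 σ).2 h (z.1.1 σ - 1)).2 (by omega)).1)
    (fun σ hσ => ⟨(Finset.mem_filter.1 hσ).2, hS σ (Finset.mem_filter.1 hσ).1⟩)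
  refine ⟨q, hq, hzq, by simpa using hys, fun σ hσ => ?_, fun τ hτ => ?_⟩
  · by_cases h : ρ σ = 0
    · exact .inl ⟨h, by rw [hneg]; simp [hσ, h]⟩
    · refine .inr ⟨h, z.1.1 σ - 1, ?_⟩
      rw [hpos]
      exact Finset.mem_union_right _ (Finset.mem_image.2 ⟨σ, by simp [hσ, h], rfl⟩)
  · rw [hpos, Finset.mem_union, Finset.mem_image] at hτ
    refine hτ.imp id ?_
    rintro ⟨σ, hσ, rfl⟩
    exact ⟨σ, (Finset.mem_filter.1 hσ).1, (Finset.mem_filter.1 hσ).2, _, rfl⟩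

/-! ### Completeness and back-and-forth -/

/-- Every child of rank less than `β` of a node of rank greater than `β` with label `1` is
explicitly given the label `0`. -/
def Complete (β : Ordinal.{0}) (p : Condition ρ) : Prop :=
  ∀ σ ∈ p.pos, β < ρ σ → ∀ k, ρ (σ ++ [k]) < β → p.Decided (σ ++ [k])

/-- By `finite_child` only finitely many children need to be decided. The witnesses added for them
have rank below `β`, so they create no new obligations. -/
theorem exists_le_complete (hρ : IsTreeRank ρ) (β : Ordinal.{0}) (p : Condition ρ) :
    ∃ q ≤ p, q.Complete β ∧ q.ys = p.ys := by
  classical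
  obtain ⟨z, hz⟩ := p.nonempty_toSet
  have hfin : (⋃ σ ∈ {σ | σ ∈ p.pos ∧ β < ρ σ},
      (fun k => σ ++ [k]) '' {k | ρ (σ ++ [k]) < β}).Finite :=
    (p.pos.finite_toSet.subset fun σ hσ => hσ.1).biUnion
      fun σ hσ => (hρ.finite_child σ β hσ.2).image _
  obtain ⟨q, hq, -, hys, hdec, hpos⟩ := exists_le_decided hz hfin.toFinset (by
    intro τ hτ
    simp only [Set.Finite.mem_toFinset, Set.mem_iUnion, Set.mem_image] at hτ
    obtain ⟨σ, hσ, k, -, rfl⟩ := hτ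
    exact ((z.1.2 σ).2 (pos_of_gt hσ.2).ne' k).1 (hz.1 σ hσ.1))
  refine ⟨q, hq, fun σ hσ hβ k hk => hdec _ ?_, hys⟩
  simp only [Set.Finite.mem_toFinset, Set.mem_iUnion, Set.mem_image] at hpos ⊢
  rcases hpos σ hσ with h | ⟨τ, ⟨υ, hυ, l, hl, rfl⟩, h0, m, rfl⟩
  · exact ⟨σ, ⟨h, hβ⟩, k, hk, rfl⟩
  · exact absurd (hβ.trans ((hρ.child_lt _ m h0).trans hl)) (lt_irrefl _)

/-- Conditions that give the same information about nodes of rank at most `β`. -/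
structure Sim (β : Ordinal.{0}) (p q : Condition ρ) : Prop where
  left : p.Complete β
  right : q.Complete β
  pos_iff : ∀ σ, ρ σ ≤ β → (σ ∈ p.pos ↔ σ ∈ q.pos)
  neg_eq : p.neg = q.neg
  ys_eq : p.ys = q.ys

theorem Sim.decided (hρ : IsTreeRank ρ) {β : Ordinal.{0}} {p q : Condition ρ} (h : Sim β p q)
    {σ : List ℕ} (hσ : ρ σ ≤ β) (hp : p.Decided σ) : q.Decided σ := by
  rcases hp with h' | ⟨h', m, hm⟩
  · exact .inl ⟨h'.1, h.neg_eq ▸ h'.2⟩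
  · exact .inr ⟨h', m, (h.pos_iff _ ((hρ.child_lt σ m h').le.trans hσ)).1 hm⟩

/-- The back-and-forth property of the relations `Sim β`. -/
theorem Sim.exists_le (hρ : IsTreeRank ρ) {β γ : Ordinal.{0}} {p p' q : Condition ρ}
    (h : Sim β p p') (hγ : γ < β) (hq : q ≤ p') : ∃ r ≤ q, ∃ s ≤ p, Sim γ s r := by
  classical
  obtain ⟨r, hr, hrc, -⟩ := exists_le_complete hρ γ q
  have hrp : r ≤ p' := hr.trans hq
  have hlow : ∀ σ ∈ p.pos, ρ σ ≤ β → σ ∈ r.pos := fun σ hσ h' => hrp.1 ((h.pos_iff σ h').1 hσ)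
  have hmem : ∀ {σ}, σ ∈ p.pos ∪ r.pos.filter (fun σ => ρ σ ≤ γ) ↔
      σ ∈ p.pos ∨ (σ ∈ r.pos ∧ ρ σ ≤ γ) := by simp
  -- Keep all of `p` and import from `r` only the positive nodes of rank at most `γ`, with its `neg`
  -- and `ys`.
  let s : Condition ρ :=
    { pos := p.pos ∪ r.pos.filter fun σ => ρ σ ≤ γ
      neg := r.neg
      ys := r.ys
      isOpen_ys := r.isOpen_ys
      nonempty_ys := r.nonempty_ys
      rank_neg := r.rank_neg
      disj := by
        intro σ hσ h'
        refine r.disj σ hσ ?_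
        rcases hmem.1 h' with h' | h'
        exacts [hlow σ h' (by rw [r.rank_neg σ hσ]; exact zero_le), h'.1]
      indep := by
        intro σ hσ h0 k hk
        rcases hmem.1 hσ with hσ | hσ <;> rcases hmem.1 hk with hk | hk
        · exact p.indep σ hσ h0 k hk
        · by_cases hβ : ρ σ ≤ β
          · exact r.indep σ (hlow σ hσ hβ) h0 k hk.1
          -- The critical case: a parent of rank above `β`, unknown to `r`, and a child imported
          -- from `r`. Completeness of `p` decides that child, and the decision passes to `p'` and
          -- hence to `r`, so `r` cannot give it label 1.
          · have hkβ := hk.2.trans_lt hγ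
            exact ((h.decided hρ hkβ.le (h.left σ hσ (not_le.1 hβ) k hkβ)).mono hrp).not_mem hk.1
        · exact r.indep σ hσ.1 h0 k
            (hlow _ hk ((hρ.child_lt σ k h0).le.trans (hσ.2.trans hγ.le)))
        · exact r.indep σ hσ.1 h0 k hk.1 }
  have hiff : ∀ σ, ρ σ ≤ γ → (σ ∈ s.pos ↔ σ ∈ r.pos) := fun σ hσ =>
    ⟨fun h' => (hmem.1 h').elim (fun h' => hlow σ h' (hσ.trans hγ.le)) fun h' => h'.1,
      fun h' => hmem.2 (.inr ⟨h', hσ⟩)⟩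
  have hsp : s ≤ p := ⟨Finset.subset_union_left, h.neg_eq ▸ hrp.2.1, h.ys_eq ▸ hrp.2.2⟩
  refine ⟨r, hr, s, hsp, fun σ hσ hγσ k hk => ?_, hrc, hiff, rfl, rfl⟩
  rcases hmem.1 hσ with hσ | hσ
  · by_cases hβ : ρ σ ≤ β
    · rcases hrc σ (hlow σ hσ hβ) hγσ k hk with h' | ⟨h0, m, hm⟩
      · exact .inl h'
      · exact .inr ⟨h0, m, (hiff _ ((hρ.child_lt _ m h0).le.trans hk.le)).2 hm⟩
    · exact (h.left σ hσ (not_le.1 hβ) k (hk.trans hγ)).mono hsp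
  · exact absurd hσ.2 (not_le.2 hγσ)

end Condition

/-! ### Topology of the space of labellings -/

theorem continuous_labellings_apply (σ : List ℕ) :
    Continuous fun z : labellings ρ × (ℕ → Bool) => z.1.1 σ :=
  (continuous_apply σ).comp (continuous_subtype_val.comp continuous_fst)

theorem isClosed_labellings (ρ : List ℕ → Ordinal.{0}) : IsClosed (labellings ρ) := by
  have hc : ∀ (σ : List ℕ) (s : Set ℕ), IsClopen {w : List ℕ → ℕ | w σ ∈ s} := fun σ s =>
    (isClopen_discrete s).preimage (continuous_apply σ)
  have himp : ∀ (p : Prop) (s : Set (List ℕ → ℕ)), IsClosed s → IsClosed {w | p → w ∈ s} := by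
    intro p s hs
    by_cases h : p <;> simp [h, hs]
  have himp' : ∀ s t : Set (List ℕ → ℕ), IsClopen s → IsClosed t → IsClosed {w | w ∈ s → w ∈ t} :=
    fun s t hs ht => by
      convert hs.compl.isClosed.union ht using 1
      ext w
      simp [imp_iff_not_or]
  simp only [labellings, Set.ofPred_forall]
  refine isClosed_iInter fun σ => IsClosed.inter (himp _ _ (hc σ (Set.Iic 1)).isClosed)
    (himp _ {w | _} ?_)
  simp only [Set.ofPred_forall]
  refine isClosed_iInter fun k => IsClosed.inter
    (himp' _ _ (hc σ {0}) (hc (σ ++ [k]) {0}ᶜ).isClosed)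
    (himp' _ {w | _} (hc σ {k + 1}) (IsClosed.inter (hc (σ ++ [k]) {0}).isClosed ?_))
  change IsClosed {w : List ℕ → ℕ | ∀ j < k, w (σ ++ [j]) ≠ 0}
  simp only [Set.ofPred_forall]
  exact isClosed_iInter fun j => isClosed_iInter fun _ => (hc (σ ++ [j]) {0}ᶜ).isClosed

instance : PolishSpace (labellings ρ) := (isClosed_labellings ρ).polishSpace

namespace Condition

theorem isOpen_toSet (p : Condition ρ) : IsOpen p.toSet := by
  have hc : ∀ (σ : List ℕ) (s : Set ℕ),
      IsOpen {z : labellings ρ × (ℕ → Bool) | z.1.1 σ ∈ s} := fun σ s =>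
    (isOpen_discrete s).preimage (continuous_labellings_apply σ)
  have h : ∀ (S : Finset (List ℕ)) (s : Set ℕ),
      IsOpen {z : labellings ρ × (ℕ → Bool) | ∀ σ ∈ S, z.1.1 σ ∈ s} := by
    intro S s
    have := isOpen_biInter_finset (s := S) fun σ _ => hc σ s
    convert this using 1
    ext z
    simp
  exact (h p.pos {0}).inter ((h p.neg {0}ᶜ).inter (p.isOpen_ys.preimage continuous_snd))

/-- The value `k + 1` at an inner node is pinned down by giving label 1 to child `k` and deciding
label 0 for the finitely many earlier children. At a node of rank 0 only the values 0 and 1 occur.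
Hence the sets `q.toSet` form a basis. -/
theorem exists_le_apply_eq {p : Condition ρ} {z : labellings ρ × (ℕ → Bool)} (hz : z ∈ p.toSet)
    (I : Finset (List ℕ)) (V : Set (ℕ → Bool)) (hV : IsOpen V) (hzV : z.2 ∈ V) :
    ∃ q ≤ p, z ∈ q.toSet ∧ ∀ z' ∈ q.toSet, (∀ σ ∈ I, z'.1.1 σ = z.1.1 σ) ∧ z'.2 ∈ V := by
  classical
  have hwit : ∀ σ, ρ σ ≠ 0 → z.1.1 σ ≠ 0 → z.1.1 (σ ++ [z.1.1 σ - 1]) = 0 ∧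
      ∀ j < z.1.1 σ - 1, z.1.1 (σ ++ [j]) ≠ 0 := fun σ h h0 =>
    ((z.1.2 σ).2 h (z.1.1 σ - 1)).2 (by omega)
  obtain ⟨q, hqp, hzq, hpos, -, hys⟩ := exists_le_of_mem hz
    ((I.filter fun σ => z.1.1 σ = 0) ∪
      ((I.filter fun σ => z.1.1 σ ≠ 0 ∧ ρ σ ≠ 0).image fun σ => σ ++ [z.1.1 σ - 1])) ∅ V hV hzV
    (by
      intro τ hτ
      simp only [Finset.mem_union, Finset.mem_image, Finset.mem_filter] at hτ
      rcases hτ with hτ | ⟨σ, hσ, rfl⟩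
      exacts [hτ.2, (hwit σ hσ.2.2 hσ.2.1).1])
    (by simp)
  obtain ⟨r, hrq, hzr, -, hdec, -⟩ := exists_le_decided hzq
    ((I.filter fun σ => z.1.1 σ ≠ 0 ∧ ρ σ = 0) ∪ (I.filter fun σ => z.1.1 σ ≠ 0 ∧ ρ σ ≠ 0).biUnion
      fun σ => (Finset.range (z.1.1 σ - 1)).image fun j => σ ++ [j])
    (by
      intro τ hτ
      simp only [Finset.mem_union, Finset.mem_image, Finset.mem_filter, Finset.mem_biUnion,
        Finset.mem_range] at hτ
      rcases hτ with hτ | ⟨σ, hσ, j, hj, rfl⟩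
      exacts [hτ.2.1, (hwit σ hσ.2.2 hσ.2.1).2 j hj])
  refine ⟨r, hrq.trans hqp, hzr, fun z' hz' => ⟨fun σ hσ => ?_, ?_⟩⟩
  · have hz'q := toSet_mono hrq hz'
    by_cases h0 : z.1.1 σ = 0
    · rw [h0]
      refine hz'q.1 σ ?_
      rw [hpos]
      simp [hσ, h0]
    by_cases hr : ρ σ = 0
    · have h₁ := (z.1.2 σ).1 hr
      have h₂ := (z'.1.2 σ).1 hr
      have h₃ := (hdec σ (by simp [hσ, h0, hr])).ne_zero hz'
      omega
    · have h₁ : z'.1.1 (σ ++ [z.1.1 σ - 1]) = 0 := by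
        refine hz'q.1 _ ?_
        rw [hpos]
        refine Finset.mem_union_right _ (Finset.mem_union_right _ ?_)
        exact Finset.mem_image.2 ⟨σ, by simp [hσ, h0, hr], rfl⟩
      have h₂ : ∀ j < z.1.1 σ - 1, z'.1.1 (σ ++ [j]) ≠ 0 := fun j hj =>
        (hdec _ (Finset.mem_union_right _ (Finset.mem_biUnion.2 ⟨σ, by simp [hσ, h0, hr],
          Finset.mem_image.2 ⟨j, by simpa using hj, rfl⟩⟩))).ne_zero hz'
      have h₃ : z'.1.1 σ ≠ 0 := fun h => ((z'.1.2 σ).2 hr _).1 h h₁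
      have h₄ := ((z'.1.2 σ).2 hr (z'.1.1 σ - 1)).2 (by omega)
      have h₅ : ¬ z'.1.1 σ - 1 < z.1.1 σ - 1 := fun h => h₂ _ h h₄.1
      have h₆ : ¬ z.1.1 σ - 1 < z'.1.1 σ - 1 := fun h => h₄.2 _ h h₁
      omega
  · have := (toSet_mono hrq hz').2.2
    rw [hys] at this
    exact this.2

theorem exists_le_subset {p : Condition ρ} {z : labellings ρ × (ℕ → Bool)} (hz : z ∈ p.toSet)
    {U : Set (labellings ρ × (ℕ → Bool))} (hU : IsOpen U) (hzU : z ∈ U) :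
    ∃ q ≤ p, z ∈ q.toSet ∧ q.toSet ⊆ U := by
  obtain ⟨O, V, hO, hV, hzO, hzV, hOV⟩ := isOpen_prod_iff.1 hU z.1 z.2 hzU
  obtain ⟨O', hO', rfl⟩ := isOpen_induced_iff.1 hO
  obtain ⟨I, u, hu, hIu⟩ := isOpen_pi_iff.1 hO' _ hzO
  obtain ⟨q, hq, hzq, h⟩ := exists_le_apply_eq hz I V hV hzV
  refine ⟨q, hq, hzq, fun z' hz' => hOV ⟨hIu fun σ hσ => ?_, (h z' hz').2⟩⟩
  rw [(h z' hz').1 σ hσ]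
  exact (hu σ hσ).2

/-! ### Forcing in the sense of Baire category -/

/-- `p` forces `A` if almost every point (in the sense of category) of `p` is in `A`. -/
def Forces (p : Condition ρ) (A : Set (labellings ρ × (ℕ → Bool))) : Prop :=
  ∀ᶠ z in residual _, z ∈ p.toSet → z ∈ A

variable {A : Set (labellings ρ × (ℕ → Bool))}

theorem Forces.mono {p q : Condition ρ} (h : q ≤ p) (hp : p.Forces A) : q.Forces A :=
  Filter.Eventually.mono hp fun _ hz hq => hz (toSet_mono h hq)

theorem forces_of_subset {p : Condition ρ} (h : p.toSet ⊆ A) : p.Forces A :=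
  Filter.Eventually.of_forall fun _ hz => h hz

theorem exists_mem_of_eventually {U : Set (labellings ρ × (ℕ → Bool))} (hU : IsOpen U)
    (hne : U.Nonempty) {P : labellings ρ × (ℕ → Bool) → Prop} (hP : ∀ᶠ z in residual _, P z) :
    ∃ z ∈ U, P z := by
  obtain ⟨z, hz, hz'⟩ := (dense_of_mem_residual hP).inter_open_nonempty U hU hne
  exact ⟨z, hz, hz'⟩

theorem Forces.not_compl {p : Condition ρ} (hp : p.Forces A) : ¬ p.Forces Aᶜ := fun hp' => by
  obtain ⟨z, hz, h, h'⟩ := exists_mem_of_eventually p.isOpen_toSet p.nonempty_toSet (hp.and hp')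
  exact h' hz (h hz)

/-- Modulo a meagre set, the complement of `A` is an open set `U`. Either `U` meets `p`, and a
smaller condition fits inside it, or `p` forces `A`. -/
theorem exists_forces_compl {p : Condition ρ} (hA : BaireMeasurableSet A) (h : ¬ p.Forces A) :
    ∃ q ≤ p, q.Forces Aᶜ := by
  obtain ⟨U, hU, hAU⟩ := hA.compl.residualEq_isOpen
  rw [Filter.eventuallyEq_set] at hAU
  by_cases hne : (p.toSet ∩ U).Nonempty
  · obtain ⟨z, hzp, hzU⟩ := hne
    obtain ⟨q, hq, -, hqU⟩ := exists_le_subset hzp hU hzU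
    exact ⟨q, hq, Filter.Eventually.mono hAU fun z hz hzq => hz.2 (hqU hzq)⟩
  · refine absurd (Filter.Eventually.mono hAU fun z hz hzp => ?_) h
    by_contra hzA
    exact hne ⟨z, hzp, hz.1 hzA⟩

theorem exists_forces_of_iUnion {p : Condition ρ} {A : ℕ → Set (labellings ρ × (ℕ → Bool))}
    (hA : ∀ n, BaireMeasurableSet (A n)) (h : p.Forces (⋃ n, A n)) :
    ∃ q ≤ p, ∃ n, q.Forces (A n) := by
  by_contra! hn
  have hc : ∀ n, p.Forces (A n)ᶜ := by
    intro n
    by_contra hp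
    obtain ⟨q, hq, hqA⟩ := exists_forces_compl (hA n).compl hp
    exact hn q hq n (by rwa [compl_compl] at hqA)
  refine h.not_compl ?_
  filter_upwards [eventually_countable_forall.2 hc] with z hz hzp
  simpa using fun n => hz n hzp

theorem exists_nil_mem_pos (ρ : List ℕ → Ordinal.{0}) : ∃ p : Condition ρ, [] ∈ p.pos := by
  refine ⟨⟨{[]}, ∅, Set.univ, isOpen_univ, Set.univ_nonempty, ?_, ?_, ?_⟩, ?_⟩ <;> simp

/-- Shrinking `ys` to a basic open set leaves only finitely many digits constrained; `N` lies beyond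
them. -/
theorem exists_le_update_mem (p : Condition ρ) : ∃ q ≤ p, ∃ N, ∀ n ≥ N, ∀ y ∈ q.ys,
    Function.update y n (!y n) ∈ q.ys := by
  obtain ⟨z, hz⟩ := p.nonempty_toSet
  obtain ⟨I, u, hu, hIu⟩ := isOpen_pi_iff.1 p.isOpen_ys _ hz.2.2
  have hV : IsOpen {y : ℕ → Bool | ∀ i ∈ I, y i ∈ ({z.2 i} : Set Bool)} :=
    isOpen_set_pi I.finite_toSet fun i _ => isOpen_discrete {z.2 i}
  obtain ⟨q, hq, -, -, -, hys⟩ := exists_le_of_mem hz ∅ ∅ _ hV (fun _ _ => rfl) (by simp) (by simp)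
  have hys' : ∀ y, y ∈ q.ys ↔ ∀ i ∈ I, y i = z.2 i := by
    intro y
    rw [hys]
    refine ⟨fun h => h.2, fun h => ⟨hIu fun i hi => ?_, h⟩⟩
    rw [h i hi]
    exact (hu i hi).2
  refine ⟨q, hq, I.sup id + 1, fun n hn y hy => (hys' _).2 fun i hi => ?_⟩
  have : i ≤ I.sup id := Finset.le_sup (f := id) hi
  rw [Function.update_of_ne (by omega)]
  exact (hys' y).1 hy i hi

end Condition

/-! ### Forcing `Σ⁰_β` sets by information of low rank -/

theorem IsSigma0.measurableSet {X : Type*} [TopologicalSpace X] [MeasurableSpace X] [BorelSpace X]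
    {β : Ordinal.{0}} {A : Set X} (h : IsSigma0 β A) : MeasurableSet A := by
  induction h with
  | isOpen hU => exact hU.measurableSet
  | iUnion _ _ _ _ _ _ ih => exact .iUnion fun n => .of_compl (ih n)

theorem IsSigma0.baireMeasurableSet_preimage {X Y : Type*} [TopologicalSpace X]
    [TopologicalSpace Y] {f : Y → X} (hf : Continuous f) {β : Ordinal.{0}} {A : Set X}
    (h : IsSigma0 β A) : BaireMeasurableSet (f ⁻¹' A) := by
  borelize X Y
  exact (hf.measurable h.measurableSet).baireMeasurableSet

/-- A continuous map for which membership of `f z` in a basic open set depends only on finitely many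
leaf labels and on the second coordinate. -/
structure IsLeafMap {X : Type*} [TopologicalSpace X] (f : labellings ρ × (ℕ → Bool) → X) :
    Prop where
  continuous : Continuous f
  exists_finset : ∀ U : Set X, IsOpen U → ∀ z, f z ∈ U → ∃ S : Finset (List ℕ),
    (∀ σ ∈ S, ρ σ = 0) ∧ ∃ V : Set (ℕ → Bool), IsOpen V ∧ z.2 ∈ V ∧
      ∀ z' : labellings ρ × (ℕ → Bool), (∀ σ ∈ S, z'.1.1 σ = 0 ↔ z.1.1 σ = 0) → z'.2 ∈ V → f z' ∈ U

open Condition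

variable {X : Type*} [TopologicalSpace X] {f : labellings ρ × (ℕ → Bool) → X}

theorem IsLeafMap.exists_le_sim (hf : IsLeafMap f) {U : Set X} (hU : IsOpen U)
    {p : Condition ρ} {z : labellings ρ × (ℕ → Bool)} (hz : z ∈ p.toSet) (hzU : f z ∈ U) :
    ∃ q ≤ p, ∀ r ≤ q, ∀ s, Sim 0 s r → s.Forces (f ⁻¹' U) := by
  classical
  obtain ⟨S, hS, V, hV, hzV, hSV⟩ := hf.exists_finset U hU z hzU
  obtain ⟨q, hq, -, hpos, hneg, hys⟩ := exists_le_of_mem hz (S.filter fun σ => z.1.1 σ = 0)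
    (S.filter fun σ => z.1.1 σ ≠ 0) V hV hzV (by simp) (fun σ hσ => by
      rw [Finset.mem_filter] at hσ
      exact ⟨hS σ hσ.1, hσ.2⟩)
  refine ⟨q, hq, fun r hr s hs => forces_of_subset fun z' hz' => hSV z' (fun σ hσ => ?_) ?_⟩
  · by_cases h0 : z.1.1 σ = 0
    · simp only [h0, iff_true]
      refine hz'.1 σ ((hs.pos_iff σ (hS σ hσ).le).2 (hr.1 ?_))
      rw [hpos]
      simp [hσ, h0]
    · simp only [h0, iff_false]
      refine hz'.2.1 σ ?_
      rw [hs.neg_eq]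
      refine hr.2.1 ?_
      rw [hneg]
      simp [hσ, h0]
  · have := hr.2.2 (hs.ys_eq ▸ hz'.2.2)
    rw [hys] at this
    exact this.2

/-- If a condition forces a `Σ⁰_β` set, then some stronger condition does so by means of its
information about nodes of rank at most some `δ < β`. -/
theorem IsLeafMap.exists_sim_of_forces (hρ : IsTreeRank ρ) (hf : IsLeafMap f) {β : Ordinal.{0}}
    {A : Set X} (hA : IsSigma0 β A) (p : Condition ρ) (hp : p.Forces (f ⁻¹' A)) :
    ∃ q ≤ p, ∃ δ < β, ∀ r ≤ q, ∀ s, Sim δ s r → s.Forces (f ⁻¹' A) := by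
  induction hA generalizing p with
  | isOpen hU =>
    obtain ⟨z, hz, hzU⟩ := exists_mem_of_eventually p.isOpen_toSet p.nonempty_toSet hp
    obtain ⟨q, hq, h⟩ := hf.exists_le_sim hU hz (hzU hz)
    exact ⟨q, hq, 0, zero_lt_one, h⟩
  | @iUnion β hβ γ A hγ hγβ hA ih =>
    have hB := fun n => (hA n).baireMeasurableSet_preimage hf.continuous
    rw [Set.preimage_iUnion] at hp
    obtain ⟨q, hq, n, hn⟩ := exists_forces_of_iUnion (fun n => .of_compl (hB n)) hp
    -- If `s` failed to force `A n`, an extension would force its complement, by induction through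
    -- information of some rank `δ < γ n`. Back-and-forth carries this information to an extension
    -- of `r`, which forces `A n` as well.
    refine ⟨q, hq, γ n, hγβ n, fun r hr s hs => ?_⟩
    refine Filter.Eventually.mono (?_ : s.Forces (f ⁻¹' A n)) fun z hz hzs =>
      Set.mem_iUnion.2 ⟨n, hz hzs⟩
    by_contra hsA
    obtain ⟨s', hs', hs'A⟩ := exists_forces_compl (.of_compl (hB n)) hsA
    obtain ⟨t, ht, δ, hδ, h⟩ := ih n s' hs'A
    have hsim : Sim (γ n) r s := ⟨hs.right, hs.left, fun σ hσ => (hs.pos_iff σ hσ).symm,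
      hs.neg_eq.symm, hs.ys_eq.symm⟩
    obtain ⟨u, hu, v, hv, huv⟩ := hsim.exists_le hρ hδ (ht.trans hs')
    exact (hn.mono (hv.trans hr)).not_compl (h u hu v huv)

/-! ### Flipping a digit and changing the label of the root -/

/-- Flipping the `n`-th digit of the second coordinate. -/
def flipDigit (n : ℕ) (z : labellings ρ × (ℕ → Bool)) : labellings ρ × (ℕ → Bool) :=
  (z.1, Function.update z.2 n (!z.2 n))

theorem flipDigit_flipDigit (n : ℕ) (z : labellings ρ × (ℕ → Bool)) :
    flipDigit n (flipDigit n z) = z := by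
  simp [flipDigit]

theorem continuous_flipDigit (n : ℕ) :
    Continuous (flipDigit n : labellings ρ × (ℕ → Bool) → labellings ρ × (ℕ → Bool)) := by
  refine continuous_fst.prodMk (continuous_snd.update n ?_)
  exact (continuous_of_discreteTopology (f := not)).comp ((continuous_apply n).comp continuous_snd)

theorem eventually_flipDigit (n : ℕ) {P : labellings ρ × (ℕ → Bool) → Prop}
    (hP : ∀ᶠ z in residual _, P z) : ∀ᶠ z in residual _, P (flipDigit n z) := by
  let e : labellings ρ × (ℕ → Bool) ≃ₜ labellings ρ × (ℕ → Bool) :=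
    ⟨⟨flipDigit n, flipDigit n, flipDigit_flipDigit n, flipDigit_flipDigit n⟩,
      continuous_flipDigit n, continuous_flipDigit n⟩
  exact tendsto_residual_of_isOpenMap e.continuous e.isOpenMap hP

theorem IsLeafMap.exists_flip (hρ : IsTreeRank ρ) (hf : IsLeafMap f) (h0 : ρ [] ≠ 0)
    (A : ℕ → Set X) (hA : ∀ n, IsSigma0 (ρ []) (A n)) (hcov : ∀ x, ∃ n, x ∈ A n) :
    ∃ n k z, f z ∈ A n ∧ f (flipDigit k z) ∈ A n ∧ z.1.1 [] = k + 1 ∧ z.2 k = false := by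
  classical
  obtain ⟨p, hp⟩ := exists_nil_mem_pos ρ
  obtain ⟨q, hq, n, hn⟩ := exists_forces_of_iUnion (p := p)
    (fun n => (hA n).baireMeasurableSet_preimage hf.continuous)
    (forces_of_subset fun z _ => Set.mem_iUnion.2 (hcov (f z)))
  obtain ⟨q, hq', δ, hδ, h⟩ := hf.exists_sim_of_forces hρ (hA n) q hn
  obtain ⟨r, hr, N, hN⟩ := exists_le_update_mem q
  obtain ⟨s, hs, hsc, hys⟩ := exists_le_complete hρ δ r
  have hroot : ∀ {t : Condition ρ}, t ≤ s → [] ∈ t.pos := fun ht =>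
    (ht.trans (hs.trans (hr.trans (hq'.trans hq)))).1 hp
  obtain ⟨z, hz⟩ := s.nonempty_toSet
  -- In `s` the root has label 1, so all its children have label 0; those below `N` are now decided
  -- explicitly.
  obtain ⟨t, ht, -, hys', hdec, -⟩ := exists_le_decided hz
    ((Finset.range N).image fun j => [] ++ [j]) (by
      intro τ hτ
      obtain ⟨j, -, rfl⟩ := Finset.mem_image.1 hτ
      exact ((z.1.2 []).2 h0 j).1 (hz.1 _ (hroot le_rfl)))
  -- the part of `s` below rank `δ`
  obtain ⟨u, hu⟩ : ∃ u : Condition ρ, u.pos = s.pos.filter (fun σ => ρ σ ≤ δ) ∧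
      u.neg = s.neg ∧ u.ys = s.ys :=
    ⟨{ pos := s.pos.filter fun σ => ρ σ ≤ δ
       neg := s.neg
       ys := s.ys
       isOpen_ys := s.isOpen_ys
       nonempty_ys := s.nonempty_ys
       rank_neg := s.rank_neg
       disj := fun σ hσ h' => s.disj σ hσ (Finset.mem_filter.1 h').1
       indep := fun σ hσ h' k hk =>
        s.indep σ (Finset.mem_filter.1 hσ).1 h' k (Finset.mem_filter.1 hk).1 }, rfl, rfl, rfl⟩
  -- `u` is vacuously complete: it has no positive node of rank above `δ`.
  have huA : u.Forces (f ⁻¹' A n) := by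
    refine h s (hs.trans hr) u ⟨fun σ hσ h' => ?_, hsc, fun σ hσ => ?_, hu.2.1, hu.2.2⟩
    · rw [hu.1] at hσ
      exact absurd (Finset.mem_filter.1 hσ).2 (not_le.2 h')
    · rw [hu.1]
      simp [hσ]
  -- `v` replaces label 1 at the root by label 1 at a fresh child, which makes the root label 0. It
  -- does not extend `t`, but it extends `u`, which ignores the root.
  obtain ⟨m, hm⟩ := exists_fresh (t.pos ∪ t.neg)
  obtain ⟨v, hv⟩ : ∃ v : Condition ρ, v.pos = insert ([] ++ [m]) (t.pos.erase []) ∧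
      v.neg = t.neg ∧ v.ys = t.ys :=
    ⟨{ pos := insert ([] ++ [m]) (t.pos.erase [])
       neg := t.neg
       ys := t.ys
       isOpen_ys := t.isOpen_ys
       nonempty_ys := t.nonempty_ys
       rank_neg := t.rank_neg
       disj := by
        intro σ hσ h'
        rcases Finset.mem_insert.1 h' with rfl | h'
        · exact hm _ (Finset.mem_union_right _ hσ) (by simp)
        · exact t.disj σ hσ (Finset.mem_of_mem_erase h')
       indep := by
        intro σ hσ h' k hk
        rcases Finset.mem_insert.1 hk with hk | hk
        · obtain ⟨rfl, -⟩ := List.append_inj' hk rfl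
          rcases Finset.mem_insert.1 hσ with hσ | hσ
          · simp at hσ
          · simp at hσ
        · rcases Finset.mem_insert.1 hσ with rfl | hσ
          · exact hm _ (Finset.mem_union_left _ (Finset.mem_of_mem_erase hk)) (by simp)
          · exact t.indep σ (Finset.mem_of_mem_erase hσ) h' k (Finset.mem_of_mem_erase hk) },
      rfl, rfl, rfl⟩
  have hvu : v ≤ u := by
    refine ⟨fun σ hσ => ?_, ?_, ?_⟩
    · rw [hu.1, Finset.mem_filter] at hσ
      rw [hv.1]
      refine Finset.mem_insert_of_mem (Finset.mem_erase.2 ⟨?_, ht.1 hσ.1⟩)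
      rintro rfl
      exact absurd hσ.2 (not_le.2 hδ)
    · rw [hu.2.1, hv.2.1]
      exact ht.2.1
    · rw [hu.2.2, hv.2.2]
      exact ht.2.2
  obtain ⟨z, hz⟩ := v.nonempty_toSet
  have hz0 : z.1.1 [] ≠ 0 := fun h' =>
    ((z.1.2 []).2 h0 m).1 h' (hz.1 _ (by rw [hv.1]; exact Finset.mem_insert_self _ _))
  obtain ⟨k, hk⟩ : ∃ k, z.1.1 [] = k + 1 := ⟨_, (Nat.succ_pred_eq_of_ne_zero hz0).symm⟩
  -- The children decided by `t` keep label 0 in `v`, since only the root was removed from `pos`.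
  have hkN : N ≤ k := by
    by_contra! hlt
    have hzk := (((z.1.2 []).2 h0 k).2 hk).1
    rcases hdec _ (Finset.mem_image.2 ⟨k, Finset.mem_range.2 hlt, rfl⟩) with h' | ⟨h', l, hl⟩
    · exact hz.2.1 _ (by rw [hv.2.1]; exact h'.2) hzk
    · refine ((z.1.2 _).2 h' l).1 hzk (hz.1 _ ?_)
      rw [hv.1]
      exact Finset.mem_insert_of_mem (Finset.mem_erase.2 ⟨by simp, hl⟩)
  have hopen : IsOpen (v.toSet ∩ {z | z.1.1 [] ∈ ({k + 1} : Set ℕ)}) :=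
    v.isOpen_toSet.inter ((isOpen_discrete _).preimage (continuous_labellings_apply []))
  have hvA : v.Forces (f ⁻¹' A n) := huA.mono hvu
  obtain ⟨z, ⟨hz, hzk⟩, hz₁, hz₂⟩ :=
    exists_mem_of_eventually hopen ⟨z, hz, hk⟩ (hvA.and (eventually_flipDigit k hvA))
  have hzf : flipDigit k z ∈ v.toSet := by
    refine ⟨hz.1, hz.2.1, ?_⟩
    have := hz.2.2
    rw [hv.2.2, hys', hys] at this ⊢
    exact hN k hkN _ this
  -- Edges go from the point whose digit `k` is 0, so the pair may have to be swapped.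
  cases hb : z.2 k with
  | false => exact ⟨n, k, z, hz₁ hz, hz₂ hzf, hzk, hb⟩
  | true =>
    exact ⟨n, k, flipDigit k z, hz₂ hzf, by rw [flipDigit_flipDigit]; exact hz₁ hz, hzk, by simp [flipDigit, hb]⟩

end

/-! ### Ranks in `T_α` -/

namespace CofinalSequences

variable {α : Ordinal.{0}} (F : CofinalSequences α)

open Classical in
/-- The rank of a sequence in `T_α`, extended by `0` to the sequences outside the tree. -/
noncomputable def treeRank (σ : List ℕ) : Ordinal.{0} :=
  if h : σ ∈ F.tree then F.rank ⟨σ, h⟩ else 0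

variable {F}

theorem HasRank.treeRank_eq {σ : List ℕ} {β : Ordinal.{0}} (h : F.HasRank σ β) :
    F.treeRank σ = β := by
  have hσ : σ ∈ F.tree := ⟨β, h⟩
  rw [treeRank, dif_pos hσ]
  exact (hasRank_rank ⟨σ, hσ⟩).unique h

theorem hasRank_treeRank {σ : List ℕ} (h : F.treeRank σ ≠ 0) : F.HasRank σ (F.treeRank σ) := by
  have hσ : σ ∈ F.tree := by
    by_contra hσ
    exact h (dif_neg hσ)
  rw [treeRank, dif_pos hσ]
  exact hasRank_rank ⟨σ, hσ⟩

theorem treeRank_ne_zero {σ : List ℕ} (hσ : σ ∈ F.tree) (h : σ ∉ F.leaves) :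
    F.treeRank σ ≠ 0 := by
  obtain ⟨β, hβ⟩ := hσ
  rw [hβ.treeRank_eq]
  rintro rfl
  exact h hβ

theorem isTreeRank (F : CofinalSequences α) : IsTreeRank F.treeRank where
  child_lt σ k h := by
    obtain ⟨γ, hγ, hσ⟩ := (hasRank_treeRank h).exists_child h k
    rwa [hσ.treeRank_eq]
  finite_child σ β hβ := by
    have h := hasRank_treeRank (pos_of_gt hβ).ne'
    rcases zero_or_succ_or_isSuccLimit (F.treeRank σ) with h0 | ⟨γ, hγ⟩ | hl
    · exact absurd h0 (pos_of_gt hβ).ne'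
    · rw [← hγ] at h hβ
      have hβγ : β ≤ γ := lt_succ_iff.1 hβ
      convert Set.finite_empty
      ext k
      have hk : F.HasRank (σ ++ [k]) γ := .succ (by simpa using h) k
      simpa [hk.treeRank_eq] using hβγ
    · obtain ⟨m, hm⟩ := F.cofinal _ h.le hl β hβ
      refine (Set.finite_Iio m).subset fun k hk => ?_
      -- Once `(δ_k)` has passed `β` it stays above, so only indices below `m` are possible.
      rw [Set.mem_ofPred_eq, (HasRank.limit h hl k).treeRank_eq] at hk
      exact (F.strictMono _ h.le hl).lt_iff_lt.1 (hk.trans hm)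

/-! ### From labellings to points of `𝕏_α` -/

variable (F) in
/-- The point of `𝕏_α` given by a labelling of the whole tree and a subset of `ℕ`. -/
def toSpace (z : labellings F.treeRank × (ℕ → Bool)) : F.Space :=
  (fun σ => decide (z.1.1 σ = 0), z.2)

/-- By induction on rank: the constraints and witnesses in `z` are exactly the recursion that
defines `T^x` from the leaf labels. -/
theorem label_toSpace (z : labellings F.treeRank × (ℕ → Bool)) (σ : List ℕ) (hσ : σ ∈ F.tree) :
    label (F.toSpace z).1 σ hσ = true ↔ z.1.1 σ = 0 := by
  have hwf := InvImage.wf F.treeRank (wellFounded_lt (α := Ordinal.{0}))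
  induction σ using hwf.induction with
  | _ σ ih =>
    rw [label]
    by_cases hl : σ ∈ F.leaves
    · simp [hl, toSpace]
    · have h0 := treeRank_ne_zero hσ hl
      have ih' := fun k => ih (σ ++ [k]) (F.isTreeRank.child_lt σ k h0) (append_mem_tree hσ hl k)
      by_cases hz : z.1.1 σ = 0
      · have hn : ¬ ∃ k, label (F.toSpace z).1 (σ ++ [k]) (append_mem_tree hσ hl k) = true :=
          fun ⟨k, hk⟩ => ((z.1.2 σ).2 h0 k).1 hz ((ih' k).1 hk)
        rw [dif_neg hl, if_neg hn]
        simp [hz]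
      · have := ((z.1.2 σ).2 h0 (z.1.1 σ - 1)).2 (by omega)
        have hn : ∃ k, label (F.toSpace z).1 (σ ++ [k]) (append_mem_tree hσ hl k) = true :=
          ⟨_, (ih' _).2 this.1⟩
        rw [dif_neg hl, if_pos hn]
        simp [hz]

theorem isLeafMap_toSpace (F : CofinalSequences α) : IsLeafMap F.toSpace where
  continuous := by
    refine Continuous.prodMk (continuous_pi fun σ => ?_) continuous_snd
    exact (continuous_of_discreteTopology (f := fun n : ℕ => decide (n = 0))).comp
      (continuous_labellings_apply σ.1)
  exists_finset U hU z hz := by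
    classical
    obtain ⟨O, V, hO, hV, hzO, hzV, hOV⟩ := isOpen_prod_iff.1 hU _ _ hz
    obtain ⟨I, u, hu, hIu⟩ := isOpen_pi_iff.1 hO _ hzO
    refine ⟨I.image Subtype.val, fun σ hσ => ?_, V, hV, hzV, fun z' hz' hV' =>
      hOV ⟨hIu fun σ hσ => ?_, hV'⟩⟩
    · obtain ⟨τ, -, rfl⟩ := Finset.mem_image.1 hσ
      exact HasRank.treeRank_eq τ.2
    · have : (F.toSpace z').1 σ = (F.toSpace z).1 σ := by
        simp [toSpace, hz' σ.1 (Finset.mem_image_of_mem _ hσ)]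
      change (F.toSpace z').1 σ ∈ u σ
      rw [this]
      exact (hu σ hσ).2

/-! ### Borelness and edges of `K_α` -/

theorem measurable_label (σ : List ℕ) (hσ : σ ∈ F.tree) :
    Measurable fun x : F.leaves → Bool => label x σ hσ := by
  have hwf := InvImage.wf F.treeRank (wellFounded_lt (α := Ordinal.{0}))
  induction σ using hwf.induction with
  | _ σ ih =>
    by_cases hl : σ ∈ F.leaves
    · convert measurable_pi_apply (⟨σ, hl⟩ : F.leaves) using 2 with x
      rw [label, dif_pos hl]
    · have ih' := fun k => ih (σ ++ [k]) (F.isTreeRank.child_lt σ k (treeRank_ne_zero hσ hl))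
        (append_mem_tree hσ hl k)
      have hm : MeasurableSet {x : F.leaves → Bool |
          ∃ k, label x (σ ++ [k]) (append_mem_tree hσ hl k) = true} := by
        rw [Set.ofPred_exists]
        exact .iUnion fun k => ih' k (measurableSet_singleton true)
      classical
      convert Measurable.ite hm (measurable_const (a := false)) (measurable_const (a := true))
        using 2 with x
      rw [label, dif_neg hl]

theorem singleton_mem_tree (hα : α ≠ 0) (n : ℕ) : [n] ∈ F.tree := by
  obtain ⟨γ, -, h⟩ := (HasRank.root (F := F)).exists_child hα n
  exact ⟨γ, h⟩

theorem symmDiff_toSet_eq_singleton {y y' : ℕ → Bool} {n : ℕ} :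
    symmDiff (toSet y) (toSet y') = {n} ↔ ∀ m, y m ≠ y' m ↔ m = n := by
  rw [Set.ext_iff]
  refine forall_congr' fun m => ?_
  cases h : y m <;> cases h' : y' m <;> simp [Set.mem_symmDiff, toSet, h, h']

theorem measurableSet_graphK (hα : α ≠ 0) (F : CofinalSequences α) :
    MeasurableSet {e : F.Space × F.Space | F.graphK.Adj e.1 e.2} := by
  have hlab : ∀ (σ : List ℕ) (hσ : σ ∈ F.tree),
      Measurable fun e : F.Space × F.Space => label e.1.1 σ hσ := fun σ hσ =>
    (measurable_label σ hσ).comp (measurable_fst.comp measurable_fst)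
  have h₁ : ∀ m, Measurable fun e : F.Space × F.Space => e.1.2 m := fun m =>
    (measurable_pi_apply m).comp (measurable_snd.comp measurable_fst)
  have h₂ : ∀ m, Measurable fun e : F.Space × F.Space => e.2.2 m := fun m =>
    (measurable_pi_apply m).comp (measurable_snd.comp measurable_snd)
  -- In coordinates, the edge relation involves only countable quantifiers over measurable
  -- conditions.
  have hiff : ∀ e : F.Space × F.Space, F.graphK.Adj e.1 e.2 ↔
      (∀ σ, e.2.1 σ = e.1.1 σ) ∧ label e.1.1 [] F.nil_mem_tree = false ∧ ∃ n,
        (label e.1.1 [n] (singleton_mem_tree hα n) = true ∧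
          ∀ k < n, label e.1.1 [k] (singleton_mem_tree hα k) = false) ∧
        (∀ m, (e.1.2 m = e.2.2 m) ↔ m ≠ n) ∧ e.1.2 n = false := by
    intro e
    simp only [graphK, funext_iff, symmDiff_toSet_eq_singleton]
    refine and_congr_right fun _ => and_congr_right fun _ => exists_congr fun n =>
      and_congr ?_ (and_congr (forall_congr' fun m => by tauto) (by simp [toSet]))
    simp only [IsLeast, mem_lowerBounds, Set.mem_ofPred_eq]
    refine and_congr ⟨fun ⟨_, h⟩ => h, fun h => ⟨_, h⟩⟩ ⟨fun h k hk => ?_, fun h k hk => ?_⟩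
    · by_contra hne
      exact absurd (h k ⟨_, by simpa using hne⟩) (not_le.2 hk)
    · by_contra hlt
      have := h k (not_le.1 hlt)
      simp [hk.2] at this
  simp only [hiff]
  have hand : ∀ {P Q : F.Space × F.Space → Prop}, MeasurableSet {e | P e} →
      MeasurableSet {e | Q e} → MeasurableSet {e | P e ∧ Q e} := fun hP hQ => hP.inter hQ
  refine hand ?_ (hand ?_ ?_)
  · rw [Set.ofPred_forall]
    exact .iInter fun σ => measurableSet_eq_fun
      ((measurable_pi_apply σ).comp (measurable_fst.comp measurable_snd))
      ((measurable_pi_apply σ).comp (measurable_fst.comp measurable_fst))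
  · exact hlab _ _ (measurableSet_singleton false)
  · rw [Set.ofPred_exists]
    refine .iUnion fun n => hand (hand ?_ ?_) (hand ?_ ?_)
    · exact hlab _ _ (measurableSet_singleton true)
    · simp only [Set.ofPred_forall]
      exact .iInter fun k => .iInter fun _ => hlab _ _ (measurableSet_singleton false)
    · rw [Set.ofPred_forall]
      exact .iInter fun m => (measurableSet_eq_fun (h₁ m) (h₂ m)).iff (.const _)
    · exact h₁ n (measurableSet_singleton false)

theorem adj_toSpace_flipDigit (hα : α ≠ 0) {z : labellings F.treeRank × (ℕ → Bool)} {k : ℕ}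
    (hk : z.1.1 [] = k + 1) (hzk : z.2 k = false) :
    F.graphK.Adj (F.toSpace z) (F.toSpace (flipDigit k z)) := by
  have h0 : F.treeRank [] ≠ 0 := by rwa [HasRank.root.treeRank_eq]
  have hw := ((z.1.2 []).2 h0 k).2 hk
  refine ⟨rfl, ?_, k, ⟨⟨singleton_mem_tree hα k, (label_toSpace z _ _).2 hw.1⟩, ?_⟩, ?_, ?_⟩
  · rw [← Bool.not_eq_true, label_toSpace, hk]
    simp
  · rintro j ⟨hj, hj'⟩
    by_contra hlt
    exact hw.2 j (not_le.1 hlt) ((label_toSpace z _ hj).1 hj')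
  · rw [symmDiff_toSet_eq_singleton]
    intro m
    by_cases hm : m = k
    · subst hm
      simp [toSpace, flipDigit]
    · simp [toSpace, flipDigit, hm]
  · simp [toSet, toSpace, hzk]

end CofinalSequences

theorem mainTheorem3 (α : Ordinal.{0}) (hα : 1 ≤ α) (hα' : α < ω₁) (F : CofinalSequences α) :
    MeasurableSet[borel (F.Space × F.Space)] {e : F.Space × F.Space | F.graphK.Adj e.1 e.2} ∧
      ¬ ∃ c : F.Space → ℕ, IsSigmaColouring α F.graphK c := by
  have h0 : α ≠ 0 := (zero_lt_one.trans_le hα).ne'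
  have hroot : F.treeRank [] = α := CofinalSequences.HasRank.root.treeRank_eq
  refine ⟨?_, ?_⟩
  · rw [← BorelSpace.measurable_eq (α := F.Space × F.Space)]
    exact F.measurableSet_graphK h0
  · rintro ⟨c, hc⟩
    obtain ⟨n, k, z, h₁, h₂, hk, hzk⟩ := F.isLeafMap_toSpace.exists_flip F.isTreeRank
      (by rwa [hroot]) (fun n => c ⁻¹' {n}) (by rw [hroot]; exact hc.isSigma0)
      fun x => ⟨c x, rfl⟩
    exact hc.proper _ _ (F.adj_toSpace_flipDigit h0 hk hzk)
      ((Set.mem_singleton_iff.1 h₁).trans (Set.mem_singleton_iff.1 h₂).symm)
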